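/- Let $G=(V,E)$ be a finite connected planar graph (loops and multiple edges allowed), drawn in the plane, and let $G^*=(V^*,E^*)$ be its dual with respect to this drawing: its vertices are the faces, and the edge $e^*=\langle i^*j^*\rangle$ dual to $e=\langle ij\rangle$ joins the (possibly equal) faces on the two sides of $e$. For real couplings $K_2,K_2',K_4$ the mixed Ashkin–Teller partition function is $$Z_{\rm mAT}(G,G^*;K_2,K_2',K_4)=\sum_{\sigma\in\{\pm1\}^{V}}\ \sum_{\tau\in\{\pm1\}^{V^*}}\exp\Big[\sum_{\langle ij\rangle\in E}\big(K_2\sigma_i\sigma_j+K_2'\tau_{i^*}\tau_{j^*}+K_4\sigma_i\sigma_j\tau_{i^*}\tau_{j^*}\big)\Big],$$ with edge weights $\omega_0,\omega_1,\omega_2,\omega_3$, the values of $\exp(K_2s+K_2't+K_4st)$ at $(s,t)=(1,1),(1,-1),(-1,1),(-1,-1)$. For real $L_2,L_2'$ and a finite graph $H=(W,F)$, the infinite-coupling-limit Ashkin–Teller partition function is $$Z_{\rm ICLAT}(H;L_2,L_2')=\lim_{L\to-\infty}\ \sum_{\sigma,\tau\in\{\pm1\}^{W}}\ \prod_{\langle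 ij\rangle\in F}e^{\,L_0+(L_2-L)\sigma_i\sigma_j+(L_2'-L)\tau_i\tau_j+L\sigma_i\sigma_j\tau_i\tau_j},\qquad L_0=-(L_2+L_2'-L),$$ i.e. edge weights are normalized to be $1$ when $\sigma_i\sigma_j=\tau_i\tau_j=1$. **Theorem.** Suppose $K_2=K_4>0$ and let $K_2'\in\mathbb R$. Then $\omega_3=\omega_1$, and with $\omega_0^*=\omega_0+\omega_2$ there is exactly one pair of real numbers $(L_2^*,L_2^{*\prime})$ with $$e^{-2L_2^{*\prime}}=\frac{\omega_0-\omega_2}{\omega_0+\omega_2}=\tanh(2K_2),\qquad e^{-2L_2^{*}}=\frac{2\omega_1}{\omega_0+\omega_2}=\frac{e^{-2K_2'}}{\cosh(2K_2)};$$ the second equality in each of these two formulas is part of the claim. For this pair, the limit defining $Z_{\rm ICLAT}(G^*;L_2^*,L_2^{*\prime})$ exists and $$Z_{\rm mAT}(G,G^*;K_2,K_2',K_4)=2^{-|V^*|+1}\Big[\prod_{\langle ij\rangle\in E}\omega_0^*\Big]\,Z_{\rm ICLAT}(G^*;L_2^*,L_2^{*\prime}).$$ -/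

import Mathlib

open Filter Topology

/-- A multigraph on the vertex set `V` with edge set `E`; loops and parallel edges are allowed.
Every edge `e` has two half-edges `(e, false)`, `(e, true)`, attached to the vertices
`endpt e false` and `endpt e true`. (Which one comes first is immaterial.) -/
structure Multigraph (V E : Type*) where
  endpt : E → Bool → V

namespace Multigraph

variable {V V' E : Type*}

/-- `u` and `v` are the two ends of some edge. -/
def Joined (G : Multigraph V E) (u v : V) : Prop :=
  ∃ e b, G.endpt e b = u ∧ G.endpt e (!b) = v

/-- `G` has at least one vertex, and any two vertices are connected by a path. -/
def Connected (G : Multigraph V E) : Prop :=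
  Nonempty V ∧ ∀ u v, Relation.ReflTransGen G.Joined u v

/-- The involution exchanging the two half-edges of each edge. -/
def flipEnds (E : Type*) : Equiv.Perm (E × Bool) :=
  Equiv.prodCongr (Equiv.refl E) Equiv.boolNot

/-- A drawing of `G` on an oriented surface, recorded as a rotation system: a permutation `rot`
of the half-edges whose cycles are exactly the sets of half-edges attached to a common vertex
(`rot` sends a half-edge to the next one around its vertex in counterclockwise order). -/
structure Drawing (G : Multigraph V E) where
  rot : Equiv.Perm (E × Bool)
  sameCycle_iff : ∀ d d' : E × Bool,
    rot.SameCycle d d' ↔ G.endpt d.1 d.2 = G.endpt d'.1 d'.2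

namespace Drawing

variable {G : Multigraph V E}

/-- Face tracing: follow the half-edge `d` to the other end of its edge, and go on with the next
half-edge around the vertex reached there. The cycles are the boundary walks of the faces. -/
def facePerm (D : G.Drawing) : Equiv.Perm (E × Bool) := D.rot * flipEnds E

/-- The faces: the cycles of the face tracing permutation, and one face around each isolated
vertex (in a connected graph there is an isolated vertex only if the graph is a single vertex
without edges, which has one face). -/
def Face (D : G.Drawing) : Type _ :=
  Quotient (Equiv.Perm.SameCycle.setoid D.facePerm) ⊕ {v : V // ∀ e b, G.endpt e b ≠ v}

instance [Finite V] [Finite E] (D : G.Drawing) : Finite D.Face :=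
  inferInstanceAs (Finite (_ ⊕ _))

noncomputable instance [Finite V] [Finite E] (D : G.Drawing) : Fintype D.Face :=
  Fintype.ofFinite _

noncomputable instance (D : G.Drawing) : DecidableEq D.Face := Classical.decEq _

/-- The dual graph `G*`: its vertices are the faces, and the dual of the edge `e` (again labelled
`e`) joins the faces on the two sides of `e`, which are possibly equal. -/
def dual (D : G.Drawing) : Multigraph D.Face E where
  endpt e b := Sum.inl (Quotient.mk _ (e, b))

/-- The drawing of a connected graph lies on the sphere (equivalently, in the plane): the surface
obtained by gluing a disc to every face boundary has Euler characteristic `2`, i.e. genus `0`. -/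
def IsPlanar [Fintype V] [Fintype E] (D : G.Drawing) : Prop :=
  (Fintype.card V : ℤ) - Fintype.card E + Fintype.card D.Face = 2

end Drawing

/-- For an Ising spin configuration `σ` on the vertices, the product `σᵢ σⱼ = ±1` over the two
ends `i`, `j` of the edge `e`. -/
def bond (G : Multigraph V E) (σ : V → ℤˣ) (e : E) : ℤˣ :=
  σ (G.endpt e false) * σ (G.endpt e true)

end Multigraph

namespace AshkinTeller

variable {V V' E : Type*} [Fintype V] [DecidableEq V] [Fintype V'] [DecidableEq V'] [Fintype E]

/-- The real number `±1` given by a spin. -/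
def val (s : ℤˣ) : ℝ := ((s : ℤ) : ℝ)

/-- The Boltzmann weight of one edge, as a function of the products `s = σᵢ σⱼ` and
`t = τᵢ τⱼ`. -/
noncomputable def weight (K₂ K₂' K₄ : ℝ) (s t : ℤˣ) : ℝ :=
  Real.exp (K₂ * val s + K₂' * val t + K₄ * (val s * val t))

/-- The Hamiltonian of the mixed Ashkin-Teller model, with spins `σ` on the vertices of `G` and
spins `τ` on the vertices of `G'`, where the edges of `G` and `G'` are identified. -/
noncomputable def hamiltonianMixed (G : Multigraph V E) (G' : Multigraph V' E)
    (K₂ K₂' K₄ : ℝ) (σ : V → ℤˣ) (τ : V' → ℤˣ) : ℝ :=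
  - (K₂ * ∑ e, val (G.bond σ e)) - (K₂' * ∑ e, val (G'.bond τ e))
    - K₄ * ∑ e, val (G.bond σ e) * val (G'.bond τ e)

/-- The partition function of the mixed Ashkin-Teller model on `G` and `G'`. -/
noncomputable def ZMixed (G : Multigraph V E) (G' : Multigraph V' E) (K₂ K₂' K₄ : ℝ) : ℝ :=
  ∑ σ : V → ℤˣ, ∑ τ : V' → ℤˣ, Real.exp (- hamiltonianMixed G G' K₂ K₂' K₄ σ τ)

/-- The Hamiltonian of the Ashkin-Teller model on `G`, with zero of energy `K₀` per edge. -/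
noncomputable def hamiltonian (G : Multigraph V E) (K₀ K₂ K₂' K₄ : ℝ) (σ τ : V → ℤˣ) : ℝ :=
  - ∑ e, (K₀ + K₂ * val (G.bond σ e) + K₂' * val (G.bond τ e)
    + K₄ * (val (G.bond σ e) * val (G.bond τ e)))

/-- The partition function of the Ashkin-Teller model on `G`. -/
noncomputable def Z (G : Multigraph V E) (K₀ K₂ K₂' K₄ : ℝ) : ℝ :=
  ∑ σ : V → ℤˣ, ∑ τ : V → ℤˣ, Real.exp (- hamiltonian G K₀ K₂ K₂' K₄ σ τ)

/-- The Ashkin-Teller partition function at the couplings `L₂ - L`, `L₂' - L`, `L`, with the zero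
of energy chosen such that an edge with `σᵢ = σⱼ` and `τᵢ = τⱼ` has weight `1`. -/
noncomputable def ZPreLimit (G : Multigraph V E) (L₂ L₂' L : ℝ) : ℝ :=
  Z G (-(L₂ + L₂' - L)) (L₂ - L) (L₂' - L) L

/-- The partition function of the infinite-coupling-limit Ashkin-Teller model on `G`: the limit
`L → -∞` of the above. -/
noncomputable def ZICL (G : Multigraph V E) (L₂ L₂' : ℝ) : ℝ :=
  limUnder atBot (ZPreLimit G L₂ L₂')

end AshkinTeller

/-! When `K₂ = K₄`, an edge with unsatisfied dual bond has a weight independent of the vertex spins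
(`weight_eq`). For fixed face spins `τ`, the vertex spins thus form an Ising model with coupling `2
* K₂` on the edges not crossed by a domain wall of `τ`. Its high-temperature expansion
(`sum_prod_one_add`) is a sum over even edge sets avoiding those walls, with a factor `tanh (2 *
K₂)` per edge. On the sphere the even sets are exactly the domain walls of a second face spin `τ'`
(`image_bond_dual`), each arising from two configurations (`sum_bond`). Walls of `τ` and `τ'` that
never share an edge are what the limit `L → -∞` enforces, since a doubly unsatisfied edge then has
weight `0`. Planarity enters through a count: domain walls are always even, and Euler's formula
makes the two finite sets equally large. Positivity of `K₂` only serves to make `tanh (2 * K₂)` a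
value of `exp`. -/

namespace Multigraph

variable {V E : Type*}

/-- The bond map as a homomorphism from spin configurations to edge configurations. -/
def bondHom (G : Multigraph V E) : (V → ℤˣ) →* (E → ℤˣ) where
  toFun := G.bond
  map_one' := by ext e; simp [bond]
  map_mul' σ τ := by
    funext e
    simp only [bond, Pi.mul_apply]
    exact mul_mul_mul_comm _ _ _ _

/-- A graph is spin-connected if it is nonempty and every spin configuration without
unsatisfied bonds is constant. -/
def SpinConnected (G : Multigraph V E) : Prop :=
  Nonempty V ∧ ∀ σ : V → ℤˣ, G.bond σ = 1 → ∀ u v, σ u = σ v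

theorem bond_eq_one_iff {G : Multigraph V E} {σ : V → ℤˣ} {e : E} :
    G.bond σ e = 1 ↔ σ (G.endpt e false) = σ (G.endpt e true) := by
  rw [bond, mul_eq_one_iff_eq_inv, Int.units_inv_eq_self]

theorem Connected.spinConnected {G : Multigraph V E} (hG : G.Connected) : G.SpinConnected := by
  refine ⟨hG.1, fun σ hσ u v => ?_⟩
  induction hG.2 u v with
  | refl => rfl
  | tail _ h ih =>
    obtain ⟨e, b, rfl, rfl⟩ := h
    have he := bond_eq_one_iff.1 (congrFun hσ e)
    cases b
    · exact ih.trans he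
    · exact ih.trans he.symm

theorem bond_const (G : Multigraph V E) (s : ℤˣ) : G.bond (fun _ => s) = 1 := by
  funext e
  exact bond_eq_one_iff.2 rfl

theorem card_bond_eq_one [Fintype V] [DecidableEq V] [Fintype E] {G : Multigraph V E}
    (hG : G.SpinConnected) : {σ : V → ℤˣ | G.bond σ = 1}.ncard = 2 := by
  obtain ⟨⟨v₀⟩, hG⟩ := hG
  have : {σ : V → ℤˣ | G.bond σ = 1} = Set.range (fun (s : ℤˣ) (_ : V) => s) := by
    ext σ
    constructor
    · intro h
      exact ⟨σ v₀, funext fun v => hG σ h _ _⟩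
    · rintro ⟨s, rfl⟩
      exact G.bond_const s
  rw [this, ← Set.image_univ, Set.ncard_image_of_injective _ fun s t h => congrFun h v₀,
    Set.ncard_univ, Nat.card_eq_fintype_card, Fintype.card_units_int]

/-- Any isolated vertex is the only vertex of a connected graph. -/
theorem Connected.eq_of_isolated {G : Multigraph V E} (hG : G.Connected) {v : V}
    (hv : ∀ e b, G.endpt e b ≠ v) (w : V) : w = v := by
  obtain h | ⟨u, h, -⟩ := Relation.ReflTransGen.cases_head (hG.2 v w)
  · exact h.symm
  · obtain ⟨e, b, h, -⟩ := h
    exact absurd h (hv e b)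

/-! ### Face spins and connectedness of the dual -/

namespace Drawing

variable {G : Multigraph V E}

/-- The spin of the face to which a half-edge belongs. -/
def halfEdgeSpin (D : G.Drawing) (τ : D.Face → ℤˣ) (d : E × Bool) : ℤˣ :=
  τ (D.dual.endpt d.1 d.2)

/-- Flipping is an involution, so `D.rot d` is the face-tracing successor of the flip of `d`: both
lie on the same face. -/
theorem halfEdgeSpin_flipEnds (D : G.Drawing) (τ : D.Face → ℤˣ) (d : E × Bool) :
    D.halfEdgeSpin τ (flipEnds E d) = D.halfEdgeSpin τ (D.rot d) := by
  have h : D.rot d = D.facePerm (flipEnds E d) := by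
    obtain ⟨e, b⟩ := d
    simp [facePerm, flipEnds]
  rw [h]
  refine congrArg τ (congrArg Sum.inl (Quotient.sound ?_))
  exact (Equiv.Perm.sameCycle_apply_right (f := D.facePerm)).2 (Equiv.Perm.SameCycle.refl _ _)

theorem bond_dual (D : G.Drawing) (τ : D.Face → ℤˣ) (d : E × Bool) :
    D.dual.bond τ d.1 = D.halfEdgeSpin τ d * D.halfEdgeSpin τ (flipEnds E d) := by
  obtain ⟨e, b⟩ := d
  cases b
  · rfl
  · exact mul_comm _ _

theorem halfEdgeSpin_flipEnds_of_bond_eq_one (D : G.Drawing) {τ : D.Face → ℤˣ}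
    (hτ : D.dual.bond τ = 1) (d : E × Bool) :
    D.halfEdgeSpin τ (flipEnds E d) = D.halfEdgeSpin τ d := by
  have h := D.bond_dual τ d
  rw [hτ, Pi.one_apply, eq_comm, mul_eq_one_iff_eq_inv, Int.units_inv_eq_self] at h
  exact h.symm

/-- One turn about a vertex, from `d` to `D.rot d`, crosses a single edge into the face of the flip
of `d`; without domain walls the spin survives. -/
theorem halfEdgeSpin_eq_of_sameCycle [Finite E] (D : G.Drawing) {τ : D.Face → ℤˣ}
    (hτ : D.dual.bond τ = 1) {d d' : E × Bool} (h : D.rot.SameCycle d d') :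
    D.halfEdgeSpin τ d = D.halfEdgeSpin τ d' := by
  obtain ⟨n, rfl⟩ := h.exists_nat_pow_eq
  induction n with
  | zero => rfl
  | succ n ih =>
    rw [pow_succ', Equiv.Perm.mul_apply, ← halfEdgeSpin_flipEnds,
      halfEdgeSpin_flipEnds_of_bond_eq_one D hτ]
    exact ih ((Equiv.Perm.sameCycle_pow_right).2 (Equiv.Perm.SameCycle.refl _ _))

theorem halfEdgeSpin_eq [Finite E] (D : G.Drawing) (hG : G.Connected) {τ : D.Face → ℤˣ}
    (hτ : D.dual.bond τ = 1) (d d' : E × Bool) :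
    D.halfEdgeSpin τ d = D.halfEdgeSpin τ d' := by
  have key : ∀ v, Relation.ReflTransGen G.Joined (G.endpt d.1 d.2) v →
      ∀ d' : E × Bool, G.endpt d'.1 d'.2 = v → D.halfEdgeSpin τ d = D.halfEdgeSpin τ d' := by
    intro v hv
    induction hv with
    | refl => exact fun d' h => D.halfEdgeSpin_eq_of_sameCycle hτ ((D.sameCycle_iff _ _).2 h.symm)
    | tail _ h ih =>
      obtain ⟨e, b, h₁, h₂⟩ := h
      intro d' hd'
      rw [ih (e, b) h₁, ← D.halfEdgeSpin_flipEnds_of_bond_eq_one hτ]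
      exact D.halfEdgeSpin_eq_of_sameCycle hτ ((D.sameCycle_iff _ _).2 (h₂.trans hd'.symm))
  exact key _ (hG.2 _ _) d' rfl

theorem dual_spinConnected [Finite E] (D : G.Drawing) (hG : G.Connected) :
    D.dual.SpinConnected := by
  constructor
  · by_cases hE : Nonempty E
    · exact hE.elim fun e => ⟨D.dual.endpt e false⟩
    · exact hG.1.elim fun v => ⟨Sum.inr ⟨v, fun e => (hE ⟨e⟩).elim⟩⟩
  · rintro τ hτ (x | ⟨x, hx⟩) (y | ⟨y, hy⟩)
    · induction x using Quotient.inductionOn with | _ d =>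
      induction y using Quotient.inductionOn with | _ d' =>
      exact D.halfEdgeSpin_eq hG hτ d d'
    -- A face at an isolated vertex cannot coexist with a half-edge: that vertex would be the only
    -- one.
    · induction x using Quotient.inductionOn with | _ d =>
      exact absurd (hG.eq_of_isolated hy _) (hy d.1 d.2)
    · induction y using Quotient.inductionOn with | _ d =>
      exact absurd (hG.eq_of_isolated hx _) (hx d.1 d.2)
    · obtain rfl := hG.eq_of_isolated hx y
      rfl

end Drawing

/-! ### Even edge configurations -/

/-- The bimultiplicative pairing on signs which is `-1` exactly if both entries are `-1`. -/
def signPair (a b : ℤˣ) : ℤˣ := if a = 1 then 1 else b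

theorem signPair_mul_left : ∀ a a' b : ℤˣ,
    signPair (a * a') b = signPair a b * signPair a' b := by decide

theorem signPair_mul_right : ∀ a b b' : ℤˣ,
    signPair a (b * b') = signPair a b * signPair a b' := by decide

/-- The even edge configurations: those orthogonal to all domain walls of vertex spins, i.e.
those with an even number of negative half-edges at each vertex. -/
def IsEven [Fintype E] (G : Multigraph V E) (f : E → ℤˣ) : Prop :=
  ∀ σ : V → ℤˣ, ∏ e, signPair (f e) (G.bond σ e) = 1

/-- The domain walls of face spins are even. -/
theorem Drawing.isEven_bond_dual [Fintype E] {G : Multigraph V E} (D : G.Drawing)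
    (τ : D.Face → ℤˣ) : G.IsEven (D.dual.bond τ) := by
  intro σ
  have h₁ : ∏ e, signPair (D.dual.bond τ e) (G.bond σ e) =
      ∏ d : E × Bool, signPair (D.dual.bond τ d.1) (σ (G.endpt d.1 d.2)) := by
    rw [Fintype.prod_prod_type]
    refine Finset.prod_congr rfl fun e _ => ?_
    rw [Fintype.prod_bool, mul_comm, ← signPair_mul_right]
    rfl
  -- Each half-edge factor splits into a function of `d` times the same function of `D.rot d`;
  -- reindexing by `D.rot` makes the whole product a square.
  have h₂ : ∀ d : E × Bool, signPair (D.dual.bond τ d.1) (σ (G.endpt d.1 d.2)) =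
      signPair (D.halfEdgeSpin τ d) (σ (G.endpt d.1 d.2)) *
        signPair (D.halfEdgeSpin τ (D.rot d)) (σ (G.endpt (D.rot d).1 (D.rot d).2)) := by
    intro d
    have h : G.endpt d.1 d.2 = G.endpt (D.rot d).1 (D.rot d).2 :=
      (D.sameCycle_iff _ _).1
        (Equiv.Perm.sameCycle_apply_right.2 (Equiv.Perm.SameCycle.refl _ _))
    rw [D.bond_dual, signPair_mul_left, D.halfEdgeSpin_flipEnds, ← h]
  rw [h₁, Finset.prod_congr rfl fun d _ => h₂ d, Finset.prod_mul_distrib,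
    Equiv.prod_comp D.rot fun d => signPair (D.halfEdgeSpin τ d) (σ (G.endpt d.1 d.2))]
  exact Int.units_mul_self _

end Multigraph

/-! ### High-temperature expansion and counting of domain walls -/

namespace AshkinTeller

open Multigraph

@[simp] theorem val_one : val 1 = 1 := by simp [val]

@[simp] theorem val_neg_one : val (-1) = -1 := by simp [val]

theorem val_mul (s t : ℤˣ) : val (s * t) = val s * val t := by simp [val]

theorem val_prod {ι : Type*} (s : Finset ι) (f : ι → ℤˣ) :
    val (∏ i ∈ s, f i) = ∏ i ∈ s, val (f i) := by
  simp [val, Units.coe_prod]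

variable {V E : Type*} [Fintype V] [DecidableEq V] [Fintype E]

open Classical in
/-- Orthogonality: summing the character of an edge configuration over all vertex spins. -/
theorem sum_val_signPair (G : Multigraph V E) (f : E → ℤˣ) :
    ∑ σ : V → ℤˣ, val (∏ e, signPair (f e) (G.bond σ e)) =
      if G.IsEven f then (2 : ℝ) ^ Fintype.card V else 0 := by
  split_ifs with h
  · rw [Finset.sum_congr rfl fun σ _ => by rw [h σ, val_one]]
    simp
  · simp only [IsEven, not_forall] at h
    obtain ⟨σ₀, h₀⟩ := h
    have h₀ := (Int.units_eq_one_or _).resolve_left h₀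
    -- Translation by a configuration `σ₀` that detects oddness negates the sum, which therefore
    -- vanishes.
    have key : ∑ σ : V → ℤˣ, val (∏ e, signPair (f e) (G.bond σ e)) =
        - ∑ σ : V → ℤˣ, val (∏ e, signPair (f e) (G.bond σ e)) := by
      conv_lhs => rw [← Equiv.sum_comp (Equiv.mulLeft σ₀)]
      rw [← Finset.sum_neg_distrib]
      refine Finset.sum_congr rfl fun σ _ => ?_
      have : G.bond (σ₀ * σ) = G.bond σ₀ * G.bond σ := map_mul G.bondHom σ₀ σ
      simp only [Equiv.coe_mulLeft, this, Pi.mul_apply, signPair_mul_right,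
        Finset.prod_mul_distrib, h₀]
      rw [val_mul, val_neg_one, neg_one_mul]
    linarith

open Classical in
/-- The high-temperature expansion with edge-dependent couplings. -/
theorem sum_prod_one_add (G : Multigraph V E) (x : E → ℝ) :
    ∑ σ : V → ℤˣ, ∏ e, (1 + x e * val (G.bond σ e)) =
      2 ^ Fintype.card V *
        ∑ f : E → ℤˣ with G.IsEven f, ∏ e, if f e = 1 then 1 else x e := by
  have h : ∀ σ : V → ℤˣ, ∏ e, (1 + x e * val (G.bond σ e)) =
      ∑ f : E → ℤˣ, (∏ e, if f e = 1 then 1 else x e) *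
        val (∏ e, signPair (f e) (G.bond σ e)) := by
    intro σ
    have h : ∀ e, 1 + x e * val (G.bond σ e) =
        ∑ a : ℤˣ, (if a = 1 then 1 else x e) * val (signPair a (G.bond σ e)) := by
      intro e
      simp [signPair]
    simp only [h, Finset.prod_univ_sum, Fintype.piFinset_univ, Finset.prod_mul_distrib, val_prod]
  simp only [h]
  rw [Finset.sum_comm, Finset.mul_sum, Finset.sum_filter]
  refine Finset.sum_congr rfl fun f _ => ?_
  rw [← Finset.mul_sum, sum_val_signPair]
  split_ifs <;> ring

-- The high-temperature expansion at `x = 1`: each spin term vanishes unless all bonds are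
-- satisfied, which happens for two configurations, while the other side counts even sets.
open Classical in
theorem card_isEven {G : Multigraph V E} (hG : G.SpinConnected) :
    2 ^ Fintype.card V * Finset.card {f : E → ℤˣ | G.IsEven f} = 2 * 2 ^ Fintype.card E := by
  have h := sum_prod_one_add G fun _ => 1
  have h₁ : ∀ σ : V → ℤˣ, ∏ e, (1 + 1 * val (G.bond σ e)) =
      if G.bond σ = 1 then (2 : ℝ) ^ Fintype.card E else 0 := by
    intro σ
    split_ifs with hσ
    · simp [hσ, one_add_one_eq_two]
    · obtain ⟨e, he⟩ := Function.ne_iff.1 hσ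
      refine Finset.prod_eq_zero (Finset.mem_univ e) ?_
      rw [(Int.units_eq_one_or _).resolve_left he]
      simp
  have h₂ := card_bond_eq_one hG
  rw [Set.ncard_eq_toFinset_card', Set.toFinset_ofPred] at h₂
  simp only [h₁, ite_self, Finset.prod_const_one, Finset.sum_const, nsmul_eq_mul, mul_one,
    ← Finset.sum_filter, h₂] at h
  exact_mod_cast h.symm

open Classical in
/-- In a spin-connected graph, domain walls determine the spins up to a global flip. -/
theorem sum_bond {M : Type*} [AddCommMonoid M] {G : Multigraph V E} (hG : G.SpinConnected)
    (g : (E → ℤˣ) → M) :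
    ∑ σ : V → ℤˣ, g (G.bond σ) = 2 • ∑ f ∈ Finset.univ.image G.bond, g f := by
  rw [Finset.sum_comp, ← Finset.sum_nsmul]
  refine Finset.sum_congr rfl fun f hf => ?_
  obtain ⟨σ₀, -, rfl⟩ := Finset.mem_image.1 hf
  congr 1
  have h₂ := card_bond_eq_one hG
  rw [Set.ncard_eq_toFinset_card', Set.toFinset_ofPred] at h₂
  rw [← h₂]
  -- All nonempty fibres of a homomorphism have the size of its kernel, here `2`.
  exact MonoidHom.card_fiber_eq_of_mem_range G.bondHom ⟨σ₀, rfl⟩ ⟨1, map_one _⟩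

open Classical in
/-- In a connected planar graph the even edge configurations are the domain walls of face
spins. -/
theorem image_bond_dual {G : Multigraph V E} (hG : G.Connected) (D : G.Drawing)
    (hD : D.IsPlanar) :
    Finset.univ.image D.dual.bond = ({f : E → ℤˣ | G.IsEven f} : Finset (E → ℤˣ)) := by
  refine Finset.eq_of_subset_of_card_le ?_ ?_
  · intro f hf
    obtain ⟨τ, -, rfl⟩ := Finset.mem_image.1 hf
    simpa using D.isEven_bond_dual τ
  -- With `v`, `e`, `f` the numbers of vertices, edges and faces, there are `2 ^ (e + 1 - v)` even
  -- sets and `2 ^ (f - 1)` domain walls; these agree by Euler's formula.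
  · have h₁ := card_isEven hG.spinConnected
    have h₂ := sum_bond (D.dual_spinConnected hG) fun _ => 1
    simp only [Finset.sum_const, Finset.card_univ, Fintype.card_fun, Fintype.card_units_int,
      smul_eq_mul, mul_one] at h₂
    have h₃ : Fintype.card V + Fintype.card D.Face = Fintype.card E + 2 := by
      have := hD
      unfold Drawing.IsPlanar at this
      omega
    refine le_of_mul_le_mul_left (a := 2 * 2 ^ Fintype.card V) (le_of_eq ?_) (by positivity)
    calc _ = 2 * (2 ^ Fintype.card V * Finset.card {f : E → ℤˣ | G.IsEven f}) := by ring
      _ = 2 ^ (Fintype.card E + 2) := by rw [h₁]; ring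
      _ = 2 ^ Fintype.card V * 2 ^ Fintype.card D.Face := by rw [← h₃, pow_add]
      _ = _ := by rw [h₂]; ring

/-! ### The infinite-coupling limit -/

/-- The edge weight of the infinite-coupling-limit model. -/
def limitWeight (a b : ℝ) (s t : ℤˣ) : ℝ :=
  (if s = 1 then 1 else a) * (if t = 1 then 1 else if s = 1 then b else 0)

theorem ZPreLimit_eq (G : Multigraph V E) (L₂ L₂' L : ℝ) :
    ZPreLimit G L₂ L₂' L = ∑ σ : V → ℤˣ, ∑ τ : V → ℤˣ,
      ∏ e, Real.exp (-(L₂ + L₂' - L) + (L₂ - L) * val (G.bond σ e) +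
        (L₂' - L) * val (G.bond τ e) + L * (val (G.bond σ e) * val (G.bond τ e))) := by
  simp only [ZPreLimit, Z, hamiltonian, neg_neg, Real.exp_sum]

/-- The exponent is constant in `L` except at `s = t = -1`, where it equals `4 * L - 2 * L₂ - 2 *
L₂'`. -/
theorem tendsto_exp_limitWeight (L₂ L₂' : ℝ) (s t : ℤˣ) :
    Tendsto (fun L : ℝ => Real.exp (-(L₂ + L₂' - L) + (L₂ - L) * val s +
      (L₂' - L) * val t + L * (val s * val t))) atBot
      (𝓝 (limitWeight (Real.exp (-2 * L₂)) (Real.exp (-2 * L₂')) s t)) := by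
  have hne : (-1 : ℤˣ) ≠ 1 := by decide
  obtain rfl | rfl := Int.units_eq_one_or s <;> obtain rfl | rfl := Int.units_eq_one_or t <;>
    simp only [limitWeight, val_one, val_neg_one, if_true, if_neg hne, mul_one, one_mul, mul_zero]
  · refine tendsto_const_nhds.congr fun L => ?_
    rw [eq_comm, Real.exp_eq_one_iff]
    ring
  · refine tendsto_const_nhds.congr fun L => ?_
    ring_nf
  · refine tendsto_const_nhds.congr fun L => ?_
    ring_nf
  · refine Real.tendsto_exp_atBot.comp ?_
    have h : Tendsto (fun L : ℝ => 4 * L + (-2 * L₂ - 2 * L₂')) atBot atBot :=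
      tendsto_atBot_add_const_right _ _ (tendsto_id.const_mul_atBot (by norm_num))
    refine h.congr fun L => ?_
    ring

theorem tendsto_ZPreLimit (G : Multigraph V E) (L₂ L₂' : ℝ) :
    Tendsto (ZPreLimit G L₂ L₂') atBot (𝓝 (∑ σ : V → ℤˣ, ∑ τ : V → ℤˣ,
      ∏ e, limitWeight (Real.exp (-2 * L₂)) (Real.exp (-2 * L₂')) (G.bond σ e) (G.bond τ e))) := by
  refine Tendsto.congr (fun L => (ZPreLimit_eq G L₂ L₂' L).symm) ?_
  exact tendsto_finsetSum _ fun σ _ => tendsto_finsetSum _ fun τ _ =>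
    tendsto_finsetProd _ fun e _ => tendsto_exp_limitWeight L₂ L₂' _ _

theorem ZICL_eq (G : Multigraph V E) (L₂ L₂' : ℝ) :
    ZICL G L₂ L₂' = ∑ σ : V → ℤˣ, ∑ τ : V → ℤˣ,
      ∏ e, limitWeight (Real.exp (-2 * L₂)) (Real.exp (-2 * L₂')) (G.bond σ e) (G.bond τ e) :=
  (tendsto_ZPreLimit G L₂ L₂').limUnder_eq

theorem ZMixed_eq {V' : Type*} [Fintype V'] [DecidableEq V'] (G : Multigraph V E)
    (G' : Multigraph V' E) (K₂ K₂' K₄ : ℝ) :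
    ZMixed G G' K₂ K₂' K₄ = ∑ τ : V' → ℤˣ, ∑ σ : V → ℤˣ,
      ∏ e, weight K₂ K₂' K₄ (G.bond σ e) (G'.bond τ e) := by
  rw [ZMixed, Finset.sum_comm]
  refine Finset.sum_congr rfl fun τ _ => Finset.sum_congr rfl fun σ _ => ?_
  simp only [weight, ← Real.exp_sum, hamiltonianMixed, Finset.sum_add_distrib, Finset.mul_sum]
  ring_nf

/-! ### Duality -/

/-- With equal couplings `K₂ = K₄`, the vertex spins are coupled only across edges with
satisfied dual bond. -/
theorem weight_eq (K K' : ℝ) (s t : ℤˣ) :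
    weight K K' K s t = (weight K K' K 1 1 + weight K K' K (-1) 1) / 2 *
      ((if t = 1 then 1 else Real.exp (-2 * K') / Real.cosh (2 * K)) *
        (1 + (if t = 1 then Real.tanh (2 * K) else 0) * val s)) := by
  have hne : (-1 : ℤˣ) ≠ 1 := by decide
  have hc := (Real.cosh_pos (2 * K)).ne'
  have hs : weight K K' K 1 1 + weight K K' K (-1) 1 =
      2 * (Real.exp K' * Real.cosh (2 * K)) := by
    simp only [weight, val_one, val_neg_one, Real.cosh_eq]
    rw [mul_div_assoc', mul_div_cancel₀ _ two_ne_zero, mul_add, ← Real.exp_add, ← Real.exp_add]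
    ring_nf
  rw [hs, mul_div_cancel_left₀ _ two_ne_zero]
  obtain rfl | rfl := Int.units_eq_one_or t
  · have : weight K K' K s 1 = Real.exp K' * Real.exp (2 * K * val s) := by
      rw [weight, ← Real.exp_add, val_one]
      ring_nf
    rw [this, if_pos rfl, if_pos rfl, Real.tanh_eq_sinh_div_cosh]
    field_simp
    obtain rfl | rfl := Int.units_eq_one_or s
    · simp [Real.cosh_add_sinh]
    · simp [← sub_eq_add_neg, Real.cosh_sub_sinh]
  · rw [if_neg hne, if_neg hne]
    field_simp
    rw [weight, val_neg_one, zero_mul, add_zero, mul_one, ← Real.exp_add]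
    ring_nf

/-- Duality between the mixed model and the limit weights. -/
theorem ZMixed_dual {G : Multigraph V E} (hG : G.Connected) (D : G.Drawing) (hD : D.IsPlanar)
    (K K' : ℝ) :
    ZMixed G D.dual K K' K = (2 : ℝ) ^ (-(Fintype.card D.Face : ℤ) + 1) *
      (∏ _e : E, (weight K K' K 1 1 + weight K K' K (-1) 1)) *
        ∑ τ : D.Face → ℤˣ, ∑ τ' : D.Face → ℤˣ,
          ∏ e, limitWeight (Real.exp (-2 * K') / Real.cosh (2 * K)) (Real.tanh (2 * K))
            (D.dual.bond τ e) (D.dual.bond τ' e) := by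
  classical
  rw [ZMixed_eq, Finset.mul_sum]
  refine Finset.sum_congr rfl fun τ _ => ?_
  have h := sum_bond (D.dual_spinConnected hG) fun f => ∏ e, if f e = 1 then (1 : ℝ) else
    if D.dual.bond τ e = 1 then Real.tanh (2 * K) else 0
  rw [image_bond_dual hG D hD, nsmul_eq_mul, Nat.cast_ofNat] at h
  -- Bookkeeping of powers of two: the factor `2` is the global flip of `τ'`, and `2 ^ card E`
  -- offsets the halves in `weight_eq`.
  have hE : (2 : ℝ) ^ (-(Fintype.card D.Face : ℤ) + 1) * 2 * 2 ^ Fintype.card E =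
      2 ^ Fintype.card V := by
    have : -(Fintype.card D.Face : ℤ) + 1 + 1 + Fintype.card E = Fintype.card V := by
      have := hD
      unfold Drawing.IsPlanar at this
      omega
    rw [← zpow_add_one₀ two_ne_zero, ← zpow_natCast, ← zpow_add₀ two_ne_zero, this, zpow_natCast]
  simp only [limitWeight, Finset.prod_mul_distrib, ← Finset.mul_sum]
  rw [h, Finset.sum_congr rfl fun σ _ => Finset.prod_congr rfl fun e _ => weight_eq K K' _ _]
  simp only [Finset.prod_mul_distrib, ← Finset.mul_sum, sum_prod_one_add, ← hE,
    Finset.prod_const, Finset.card_univ, div_pow]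
  field_simp

end AshkinTeller

open AshkinTeller in
theorem theorem4p3 {V E : Type*} [Fintype V] [DecidableEq V] [Fintype E]
    (G : Multigraph V E) (hG : G.Connected) (D : G.Drawing) (hD : D.IsPlanar)
    (K₂ K₂' K₄ : ℝ) (hK : K₂ = K₄) (hpos : 0 < K₂)
    (ω₀ ω₁ ω₂ ω₃ : ℝ)
    (hω₀ : ω₀ = weight K₂ K₂' K₄ 1 1) (hω₁ : ω₁ = weight K₂ K₂' K₄ 1 (-1))
    (hω₂ : ω₂ = weight K₂ K₂' K₄ (-1) 1) (hω₃ : ω₃ = weight K₂ K₂' K₄ (-1) (-1)) :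
    ω₃ = ω₁ ∧
    (ω₀ - ω₂) / (ω₀ + ω₂) = Real.tanh (2 * K₂) ∧
    2 * ω₁ / (ω₀ + ω₂) = Real.exp (-2 * K₂') / Real.cosh (2 * K₂) ∧
    (∃! L : ℝ × ℝ, Real.exp (-2 * L.2) = Real.tanh (2 * K₂) ∧
      Real.exp (-2 * L.1) = Real.exp (-2 * K₂') / Real.cosh (2 * K₂)) ∧
    ∀ L₂ L₂' : ℝ, Real.exp (-2 * L₂') = Real.tanh (2 * K₂) →
      Real.exp (-2 * L₂) = Real.exp (-2 * K₂') / Real.cosh (2 * K₂) →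
      Tendsto (ZPreLimit D.dual L₂ L₂') atBot (𝓝 (ZICL D.dual L₂ L₂')) ∧
      ZMixed G D.dual K₂ K₂' K₄ =
        (2 : ℝ) ^ (-(Fintype.card D.Face : ℤ) + 1) * (∏ _e : E, (ω₀ + ω₂)) *
          ZICL D.dual L₂ L₂' := by
  subst hK hω₀ hω₁ hω₂ hω₃
  have hne : (-1 : ℤˣ) ≠ 1 := by decide
  have hc := Real.cosh_pos (2 * K₂)
  have ht : 0 < Real.tanh (2 * K₂) := by
    rw [Real.tanh_eq_sinh_div_cosh]
    exact div_pos (Real.sinh_pos_iff.2 (by linarith)) hc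
  have hS : weight K₂ K₂' K₂ 1 1 + weight K₂ K₂' K₂ (-1) 1 ≠ 0 :=
    (add_pos (Real.exp_pos _) (Real.exp_pos _)).ne'
  refine ⟨?_, ?_, ?_, ?_, ?_⟩
  · simp only [weight, val_one, val_neg_one]
    ring_nf
  · rw [div_eq_iff hS]
    have h₁ := weight_eq K₂ K₂' 1 1
    have h₂ := weight_eq K₂ K₂' (-1) 1
    simp only [val_one, val_neg_one, if_true] at h₁ h₂
    linear_combination h₁ - h₂
  · rw [div_eq_iff hS, weight_eq K₂ K₂' 1 (-1)]
    simp only [if_neg hne]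
    ring
  · have hx : ∀ {y : ℝ}, 0 < y → Real.exp (-2 * (-Real.log y / 2)) = y := by
      intro y hy
      rw [show -2 * (-Real.log y / 2) = Real.log y by ring, Real.exp_log hy]
    refine ⟨(-Real.log (Real.exp (-2 * K₂') / Real.cosh (2 * K₂)) / 2,
      -Real.log (Real.tanh (2 * K₂)) / 2),
      ⟨hx ht, hx (div_pos (Real.exp_pos _) hc)⟩, ?_⟩
    rintro ⟨a, b⟩ ⟨hb, ha⟩
    dsimp only at ha hb
    rw [← ha, ← hb, Real.log_exp, Real.log_exp]
    ext <;> dsimp only <;> ring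
  · intro L₂ L₂' h₁ h₂
    rw [ZICL_eq]
    refine ⟨tendsto_ZPreLimit _ _ _, ?_⟩
    rw [h₁, h₂]
    exact ZMixed_dual hG D hD K₂ K₂'
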